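/- Let $I=[0,1]$ and $\lambda>1$. A \emph{uniform $\lambda$-expander} is a continuous piecewise linear map $f:I\to I$ with $|f'|=\lambda$ wherever the derivative is defined. A \emph{critical point} of $f$ is a point of the interior of $I$ at which $f$ is not a local homeomorphism. A uniform $\lambda$-expander is a \emph{$\lambda$-zig-zag} if its critical points are exactly the points $i\lambda^{-1}$, $1\le i\le\lfloor\lambda\rfloor$, that lie in the interior of $I$. It is \emph{postcritically periodic} (PCP) if $f(c)$ is a periodic point for each critical point $c$. The \emph{weak postcritical set} is $\mathrm{WPC}(f)=\{f^n(c): c \text{ critical},\ n\ge 0\}$. A map $T$ preserving a probability measure $\nu$ is \emph{weak-mixing} with respect to $\nu$ if for all measurable $A,B$ there is a set $E\subseteq\mathbb{N}$ of density $0$, i.e. $\lim_{n\to\infty}\#(E\cap\{1,\dots,n\})/n=0$, such that $\nu(T^{-n}A\cap B)\to\nu(A)\nu(B)$ as $n\to\infty$ with $n\notin E$. \textbf{Theorem.} Let $\lambda>2$ and let $f:I\to I$ be a $\lambda$-zig-zag. (1) $f$ is weak-mixing with respect to Lebesgue measure, in the following sense: $f$ has a unique invariant probability measure $\nu$ that is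 absolutely continuous with respect to Lebesgue measure; $\nu$ is equivalent to Lebesgue measure (that is, it has the same null sets); and $f$ is weak-mixing with respect to $\nu$. (2) If moreover $f$ is PCP, then $\mathrm{WPC}(f)$ is finite, and cutting $I$ at the points of $\mathrm{WPC}(f)$ gives a Markov partition of $I$ into closed subintervals $I_1,\dots,I_l$ with disjoint interiors: each $f(I_j)$ is a union of some of the $I_i$, and $f$ is injective on the interior of each $I_j$. The transition matrix $M=(m_{ij})$ of $f$, defined by $m_{ij}=1$ if $f(I_j)\supseteq I_i$ and $m_{ij}=0$ otherwise, is primitive: there is $k\ge 1$ such that every entry of $M^k$ is positive. -/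

import Mathlib

open MeasureTheory Filter Topology

noncomputable section

namespace IntervalMap

/-- A uniform `lam`-expander of `I = [0, 1]`: a continuous piecewise linear map whose derivative has
absolute value `lam > 1` wherever it is defined. -/
structure IsUniformExpander (lam : ℝ) (f : unitInterval → unitInterval) : Prop where
  one_lt : 1 < lam
  continuous : Continuous f
  piecewise_linear : ∃ (n : ℕ) (t : Fin (n + 1) → unitInterval),
    StrictMono t ∧ t 0 = 0 ∧ t (Fin.last n) = 1 ∧
      ∀ i : Fin n, ∃ s b : ℝ, (s = lam ∨ s = -lam) ∧
        ∀ x ∈ Set.Icc (t i.castSucc) (t i.succ), (f x : ℝ) = s * (x : ℝ) + b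

/-- The critical set of `f : I → I`: the interior points of `I` at which `f` is not a local
homeomorphism. The end points `0` and `1` of `I` are never counted as critical. -/
def criticalSet (f : unitInterval → unitInterval) : Set unitInterval :=
  {c | 0 < c ∧ c < 1 ∧ ¬ IsLocalHomeomorphOn f {c}}

/-- The postcritical set: all `f^n(c)` with `c` critical and `n ≥ 1`. -/
def postcriticalSet (f : unitInterval → unitInterval) : Set unitInterval :=
  {y | ∃ c ∈ criticalSet f, ∃ n : ℕ, 1 ≤ n ∧ f^[n] c = y}

/-- The weak postcritical set: critical and postcritical points together. -/
def weakPostcriticalSet (f : unitInterval → unitInterval) : Set unitInterval :=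
  criticalSet f ∪ postcriticalSet f

/-- `f` is postcritically periodic (PCP) if each critical value is a periodic point. -/
def IsPostcriticallyPeriodic (f : unitInterval → unitInterval) : Prop :=
  ∀ c ∈ criticalSet f, f c ∈ Function.periodicPts f

/-- A `lam`-zig-zag: a uniform `lam`-expander whose critical points are exactly the points
`i / lam`, `1 ≤ i ≤ ⌊lam⌋`, of the interior of `I`. (When `lam` is an integer, the last of these
points is the end point `1`, which imposes no condition.) -/
structure IsZigZag (lam : ℝ) (f : unitInterval → unitInterval) : Prop where
  expander : IsUniformExpander lam f
  critical_iff : ∀ c : unitInterval, 0 < c → c < 1 →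
    (c ∈ criticalSet f ↔ ∃ i : ℕ, 1 ≤ i ∧ i ≤ ⌊lam⌋₊ ∧ (c : ℝ) = i * lam⁻¹)

/-- The closed subinterval with end points `x i` and `x (i + 1)`. -/
def piece {l : ℕ} (x : Fin (l + 1) → unitInterval) (i : Fin l) : Set unitInterval :=
  Set.Icc (x i.castSucc) (x i.succ)

/-- Cutting `I` at the points `0 = x 0 < x 1 < ⋯ < x l = 1` gives a Markov partition for `f`:
the image of each closed subinterval is a union of closed subintervals of the partition, and `f` is
injective on the interior of each of them. -/
structure IsMarkovPartition (f : unitInterval → unitInterval) {l : ℕ}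
    (x : Fin (l + 1) → unitInterval) : Prop where
  strictMono : StrictMono x
  left : x 0 = 0
  right : x (Fin.last l) = 1
  image : ∀ i : Fin l, ∃ S : Set (Fin l), f '' piece x i = ⋃ j ∈ S, piece x j
  injOn : ∀ i : Fin l, Set.InjOn f (Set.Ioo (x i.castSucc) (x i.succ))

open Classical in
/-- The transition matrix: entry `(i, j)` is `1` if the image of the `j`-th closed subinterval
contains the `i`-th one, and `0` otherwise. -/
def transitionMatrix (f : unitInterval → unitInterval) {l : ℕ}
    (x : Fin (l + 1) → unitInterval) : Matrix (Fin l) (Fin l) ℝ :=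
  Matrix.of fun i j => if piece x i ⊆ f '' piece x j then 1 else 0

/-- A set `E` of natural numbers has density zero: `#(E ∩ {1, …, n}) / n → 0`. -/
def HasDensityZero (E : Set ℕ) : Prop :=
  Tendsto (fun n : ℕ => ((E ∩ Set.Icc 1 n).ncard : ℝ) / n) atTop (𝓝 0)

/-- `T` preserves the probability measure `ν` and is weak-mixing for it: for all measurable `A`, `B`
there is a set `E` of density zero such that `ν (T⁻ⁿ A ∩ B) → ν A * ν B` as `n → ∞`, `n ∉ E`. -/
structure IsWeakMixing {X : Type*} [MeasurableSpace X] (T : X → X) (ν : Measure X) : Prop where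
  isProbabilityMeasure : IsProbabilityMeasure ν
  measurePreserving : MeasurePreserving T ν ν
  mixing : ∀ A B : Set X, MeasurableSet A → MeasurableSet B →
    ∃ E : Set ℕ, HasDensityZero E ∧
      Tendsto (fun n : ℕ => ν.real (T^[n] ⁻¹' A ∩ B)) (atTop ⊓ 𝓟 Eᶜ) (𝓝 (ν.real A * ν.real B))

end IntervalMap

end

/-!
On each lap `[k / lam, (k + 1) / lam]` a zig-zag `f` is affine with slope `± lam`, since a change of
slope would be a fold and hence a critical point (`mem_criticalSet_of_fold`,
`IsZigZag.exists_hasLapSigns`). A lap that fits into `I = [0, 1]` is mapped onto `I`, so `f` sends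
the end points of the laps to `0` or `1`.

*Weak mixing.* Write `|·|` for Lebesgue measure and let
`D A x = |A ∩ [0, x]| - x * |A|` be the discrepancy of a measurable set `A`. It vanishes for `x = 0`
and `x = 1`, so full laps do not contribute to the change of variables formula
`|f ⁻¹' A ∩ [0, x]| = x * |A| + (σ x / lam) * D A (f x)`, where `σ x = ± 1` is the sign of the slope
on the lap of `x` (`HasLapSigns.measureReal_preimage_inter_Iic`). Two consequences follow.

* `D (f ⁻¹' A) x = (σ x / lam) * D A (f x) - x * (σ 1 / lam) * D A (f 1)`, so passing to the
  preimage multiplies the supremum of `|D A|` by at most `2 / lam < 1`. Hence the sets `f⁻ⁿ A`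
  equidistribute:
  `ρ (f⁻ⁿ A) - |f⁻ⁿ A| * ρ I → 0` for each finite measure `ρ ≪ volume` (`tendsto_measureReal_sub`).
* With `xₙ = fⁿ 1` and `cₙ = ∏ j < n, σ xⱼ / lam`, the function `h = ∑ₙ cₙ 1_[0, xₙ]` is an
  invariant density (`HasLapSigns.setIntegral_invariantDensity_preimage`). As `c₀ = 1`, `x₀ = 1` and
  `|cₙ| = lam⁻ⁿ`, it is bounded and `h ≥ 1 - 1 / (lam - 1) > 0`.

Let `ν` be the normalized measure with density `h`. Equidistribution for `ρ = ν` says that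
`|f⁻ⁿ A| → ν A`; for the restriction of `ν` to `B` it then says that `ν (f⁻ⁿ A ∩ B) → ν A * ν B`, so
`f` is even strongly mixing. For any other absolutely continuous invariant probability measure `ν'`
it says that `|f⁻ⁿ A| → ν' A`, whence `ν' = ν`.

*Primitivity.* An interval that contains no full lap is covered by two laps, so its image
contains an interval longer by at least the factor `lam / 2 > 1`; hence every nondegenerate
interval is eventually mapped onto `I` (`HasLapSigns.exists_iterate_image_eq_univ`). In the
postcritically periodic case the weak postcritical set is finite, is mapped into itself and contains `0` and `1`, so that it cuts `I` into
a Markov partition, and a Markov partition all of whose pieces are eventually mapped onto `I` has a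
primitive transition matrix (`IsMarkovPartition.isPrimitive`).
-/

namespace IntervalMap

variable {lam : ℝ} {f : unitInterval → unitInterval}

/-! ### Laps of a zig-zag -/

theorem IsUniformExpander.exists_right_slope (hf : IsUniformExpander lam f) {x : unitInterval}
    (hx : x < 1) : ∃ s : ℝ, (s = lam ∨ s = -lam) ∧ ∃ y, x < y ∧
      ∀ z ∈ Set.Icc x y, (f z : ℝ) - f x = s * ((z : ℝ) - x) := by
  obtain ⟨n, t, -, ht0, ht1, ht⟩ := hf.piecewise_linear
  obtain ⟨i, hi, hi'⟩ : ∃ i : Fin n, t i.castSucc ≤ x ∧ x < t i.succ := by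
    by_contra! h
    have key : ∀ i : Fin (n + 1), t i ≤ x :=
      Fin.induction (by rw [ht0]; exact unitInterval.nonneg') h
    exact absurd (key (Fin.last n)) (by rw [ht1]; exact not_le.2 hx)
  obtain ⟨s, b, hs, hb⟩ := ht i
  refine ⟨s, hs, _, hi', fun z hz => ?_⟩
  rw [hb z ⟨hi.trans hz.1, hz.2⟩, hb x ⟨hi, hi'.le⟩]
  ring

theorem IsUniformExpander.exists_left_slope (hf : IsUniformExpander lam f) {x : unitInterval}
    (hx : 0 < x) : ∃ s : ℝ, (s = lam ∨ s = -lam) ∧ ∃ y, y < x ∧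
      ∀ z ∈ Set.Icc y x, (f z : ℝ) - f x = s * ((z : ℝ) - x) := by
  obtain ⟨n, t, -, ht0, ht1, ht⟩ := hf.piecewise_linear
  obtain ⟨i, hi, hi'⟩ : ∃ i : Fin n, t i.castSucc < x ∧ x ≤ t i.succ := by
    by_contra! h
    have key : ∀ i : Fin (n + 1), t i < x := Fin.induction (by rwa [ht0]) h
    exact absurd (key (Fin.last n)) (by rw [ht1]; exact not_lt.2 unitInterval.le_one')
  obtain ⟨s, b, hs, hb⟩ := ht i
  refine ⟨s, hs, _, hi, fun z hz => ?_⟩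
  rw [hb z ⟨hz.1, hz.2.trans hi'⟩, hb x ⟨hi.le, hi'⟩]
  ring

/-- At a fold, where the slope changes sign, the map is not locally injective. -/
theorem mem_criticalSet_of_fold {s : ℝ} {a b c : unitInterval} (hac : a < c) (hcb : c < b)
    (hl : ∀ z ∈ Set.Icc a c, (f z : ℝ) - f c = s * ((z : ℝ) - c))
    (hr : ∀ z ∈ Set.Icc c b, (f z : ℝ) - f c = -s * ((z : ℝ) - c)) :
    c ∈ criticalSet f := by
  refine ⟨unitInterval.nonneg'.trans_lt hac, hcb.trans_le unitInterval.le_one', fun h => ?_⟩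
  obtain ⟨e, hce, rfl⟩ := h c rfl
  have hc0 : 0 ≤ (a : ℝ) := a.2.1
  have hc1 : (b : ℝ) ≤ 1 := b.2.2
  have hac' : (a : ℝ) < c := hac
  have hcb' : (c : ℝ) < b := hcb
  let p : ℝ → unitInterval := Set.projIcc 0 1 zero_le_one
  have hp : Continuous p := continuous_projIcc
  have hpc : p (c : ℝ) = c := Set.projIcc_val zero_le_one c
  have hN : ∀ᶠ d in 𝓝 (0 : ℝ), p (c + d) ∈ e.source ∧ p (c - d) ∈ e.source := by
    have h1 : Tendsto (fun d : ℝ => p (c + d)) (𝓝 0) (𝓝 c) := 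
      (hp.comp (by fun_prop : Continuous fun d : ℝ => (c : ℝ) + d)).tendsto' 0 c (by simp [hpc])
    have h2 : Tendsto (fun d : ℝ => p (c - d)) (𝓝 0) (𝓝 c) := 
      (hp.comp (by fun_prop : Continuous fun d : ℝ => (c : ℝ) - d)).tendsto' 0 c (by simp [hpc])
    exact (h1.eventually (e.open_source.mem_nhds hce)).and
      (h2.eventually (e.open_source.mem_nhds hce))
  have hN' : ∀ᶠ d in 𝓝[>] (0 : ℝ), d ∈ Set.Ioo 0 (min ((c : ℝ) - a) (b - c)) :=
    Ioo_mem_nhdsGT (lt_min (by linarith) (by linarith))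
  obtain ⟨d, ⟨hd1, hd2⟩, hd0, hd⟩ := ((hN.filter_mono nhdsWithin_le_nhds).and hN').exists
  have hd3 : d < (c : ℝ) - a := hd.trans_le (min_le_left _ _)
  have hd4 : d < (b : ℝ) - c := hd.trans_le (min_le_right _ _)
  have e1 : (p (c + d) : ℝ) = c + d := by
    rw [show p (c + d) = _ from Set.projIcc_of_mem zero_le_one ⟨by linarith, by linarith⟩]
  have e2 : (p (c - d) : ℝ) = c - d := by
    rw [show p (c - d) = _ from Set.projIcc_of_mem zero_le_one ⟨by linarith, by linarith⟩]
  have f1 := hr (p (c + d)) ⟨show (c : ℝ) ≤ p (c + d) by linarith,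
    show (p (c + d) : ℝ) ≤ b by linarith⟩
  have f2 := hl (p (c - d)) ⟨show (a : ℝ) ≤ p (c - d) by linarith,
    show (p (c - d) : ℝ) ≤ c by linarith⟩
  have h3 : p (c + d) = p (c - d) := by
    refine e.injOn hd1 hd2 (Subtype.ext ?_)
    rw [e1] at f1
    rw [e2] at f2
    linarith
  have h4 := congrArg (Subtype.val) h3
  rw [e1, e2] at h4
  linarith

theorem IsUniformExpander.exists_slope_of_notMem_criticalSet (hf : IsUniformExpander lam f)
    {c : unitInterval} (h0 : 0 < c) (h1 : c < 1) (hc : c ∉ criticalSet f) :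
    ∃ s : ℝ, (s = lam ∨ s = -lam) ∧ ∃ a b, a < c ∧ c < b ∧
      ∀ z ∈ Set.Icc a b, (f z : ℝ) - f c = s * ((z : ℝ) - c) := by
  obtain ⟨s, hs, a, hac, ha⟩ := hf.exists_left_slope h0
  obtain ⟨s', hs', b, hcb, hb⟩ := hf.exists_right_slope h1
  have hss : s' = s := by
    by_contra hne
    have : s' = -s := by
      rcases hs with rfl | rfl <;> rcases hs' with rfl | rfl <;> simp_all
    subst this
    exact hc (mem_criticalSet_of_fold hac hcb ha hb)
  subst hss
  refine ⟨s', hs, a, b, hac, hcb, fun z hz => ?_⟩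
  rcases le_total z c with h | h
  · exact ha z ⟨hz.1, h⟩
  · exact hb z ⟨h, hz.2⟩

/-- Off the critical set the slope is locally constant, hence constant on an interval. -/
theorem IsUniformExpander.exists_slope (hf : IsUniformExpander lam f) {a b : unitInterval}
    (hcrit : ∀ c ∈ Set.Ioo a b, c ∉ criticalSet f) :
    ∃ s : ℝ, (s = lam ∨ s = -lam) ∧
      ∀ x ∈ Set.Icc a b, ∀ y ∈ Set.Icc a b, (f y : ℝ) - f x = s * ((y : ℝ) - x) := by
  have hl := hf.one_lt
  -- Extending `f` to the line makes real derivatives available.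
  let F : ℝ → ℝ := fun x => f (Set.projIcc 0 1 zero_le_one x)
  have hF : Continuous F :=
    continuous_subtype_val.comp (hf.continuous.comp continuous_projIcc)
  have hFv : ∀ x : unitInterval, F x = f x := fun x => by
    simp only [F, Set.projIcc_val]
  let U : ℝ → Set ℝ := fun s => {x | ∀ᶠ z in 𝓝 x, HasDerivAt F s z}
  have hU : ∀ s, IsOpen (U s) := fun s => isOpen_setOfPred_eventually_nhds
  have hdisj : Disjoint (U lam) (U (-lam)) := by
    rw [Set.disjoint_left]
    intro x hx hx'
    have := (Eventually.self_of_nhds hx).unique (Eventually.self_of_nhds hx')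
    linarith
  have hcov : Set.Ioo (a : ℝ) b ⊆ U lam ∪ U (-lam) := by
    intro x hx
    have hx0 : 0 < x := a.2.1.trans_lt hx.1
    have hx1 : x < 1 := hx.2.trans_le b.2.2
    let c : unitInterval := ⟨x, hx0.le, hx1.le⟩
    obtain ⟨s, hs, p, q, hpc, hcq, h⟩ := hf.exists_slope_of_notMem_criticalSet
      (c := c) hx0 hx1 (hcrit c ⟨hx.1, hx.2⟩)
    have hx2 : x ∈ U s := by
      have hpq : Set.Ioo (p : ℝ) q ∈ 𝓝 x := Ioo_mem_nhds hpc hcq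
      filter_upwards [hpq] with z hz
      have hd : HasDerivAt (fun w : ℝ => (f c : ℝ) + s * (w - c)) s z := by
        simpa using (((hasDerivAt_id z).sub_const (c : ℝ)).const_mul s).const_add (f c : ℝ)
      refine hd.congr_of_eventuallyEq ?_
      filter_upwards [Ioo_mem_nhds hz.1 hz.2] with w hw
      have hw0 : 0 ≤ w := p.2.1.trans hw.1.le
      have hw1 : w ≤ 1 := hw.2.le.trans q.2.2
      have := h ⟨w, hw0, hw1⟩ ⟨hw.1.le, hw.2.le⟩
      rw [← hFv] at this
      simp only at this
      linarith
    rcases hs with rfl | rfl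
    · exact Or.inl hx2
    · exact Or.inr hx2
  have main : ∃ s : ℝ, (s = lam ∨ s = -lam) ∧ Set.Ioo (a : ℝ) b ⊆ U s := by
    rcases IsPreconnected.subset_or_subset (hU _) (hU _) hdisj hcov isPreconnected_Ioo with h | h
    · exact ⟨_, Or.inl rfl, h⟩
    · exact ⟨_, Or.inr rfl, h⟩
  obtain ⟨s, hs, hsub⟩ := main
  refine ⟨s, hs, ?_⟩
  have lt_case : ∀ x ∈ Set.Icc a b, ∀ y ∈ Set.Icc a b, x < y →
      (f y : ℝ) - f x = s * ((y : ℝ) - x) := by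
    intro x hx y hy hxy
    have hxy' : (x : ℝ) < y := hxy
    obtain ⟨c, -, hc⟩ := exists_hasDerivAt_eq_slope F (fun _ => s) hxy' hF.continuousOn
      (fun z hz => Eventually.self_of_nhds
        (hsub ⟨lt_of_le_of_lt hx.1 hz.1, lt_of_lt_of_le hz.2 hy.2⟩))
    rw [hFv, hFv, eq_div_iff (by linarith)] at hc
    exact hc.symm
  intro x hx y hy
  rcases lt_trichotomy x y with h | rfl | h
  · exact lt_case x hx y hy h
  · simp
  · linarith [lt_case y hy x hx h]

/-- The map `f` is affine with slope `ε k * lam`, where `ε k = ±1`, on the `k`-th lap: the set of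
all `x` in `I` with `k ≤ lam * x ≤ k + 1`. The sign of a lap with at most one point is arbitrary. -/
structure HasLapSigns (lam : ℝ) (f : unitInterval → unitInterval) (ε : ℕ → ℝ) : Prop where
  sign : ∀ k, ε k = 1 ∨ ε k = -1
  sub_eq : ∀ (k : ℕ) (x y : unitInterval), k ≤ lam * x → lam * x ≤ k + 1 → k ≤ lam * y →
    lam * y ≤ k + 1 → (f y : ℝ) - f x = ε k * lam * ((y : ℝ) - x)

theorem IsZigZag.exists_hasLapSigns (hf : IsZigZag lam f) : ∃ ε : ℕ → ℝ, HasLapSigns lam f ε := by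
  have hl := hf.expander.one_lt
  have hl0 : 0 < lam := by linarith
  have key : ∀ k : ℕ, ∃ e : ℝ, (e = 1 ∨ e = -1) ∧ ∀ x y : unitInterval, k ≤ lam * x →
      lam * x ≤ k + 1 → k ≤ lam * y → lam * y ≤ k + 1 →
      (f y : ℝ) - f x = e * lam * ((y : ℝ) - x) := by
    intro k
    by_cases hk : (k : ℝ) < lam
    · have ha1 : (k : ℝ) / lam < 1 := (div_lt_one hl0).2 hk
      let a : unitInterval := ⟨k / lam, by positivity, ha1.le⟩
      let b : unitInterval := ⟨min ((k + 1) / lam) 1,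
        le_min (by positivity) zero_le_one, min_le_right _ _⟩
      have mem : ∀ x : unitInterval, k ≤ lam * x → lam * x ≤ k + 1 → x ∈ Set.Icc a b := by
        intro x h1 h2
        refine ⟨?_, ?_⟩
        · change (k : ℝ) / lam ≤ x
          rw [div_le_iff₀ hl0]
          linarith
        · change (x : ℝ) ≤ min ((k + 1) / lam) 1
          refine le_min ?_ x.2.2
          rw [le_div_iff₀ hl0]
          linarith
      have hcrit : ∀ c ∈ Set.Ioo a b, c ∉ criticalSet f := by
        rintro c ⟨hac, hcb⟩ hc
        obtain ⟨i, -, -, hi⟩ := (hf.critical_iff c hc.1 hc.2.1).1 hc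
        have h1 : (k : ℝ) / lam < c := hac
        have h2 : (c : ℝ) < (k + 1) / lam := lt_of_lt_of_le hcb (min_le_left _ _)
        rw [hi, ← div_eq_mul_inv, div_lt_div_iff_of_pos_right hl0] at h1 h2
        have h1' : k < i := by exact_mod_cast h1
        have h2' : i < k + 1 := by exact_mod_cast h2
        omega
      obtain ⟨s, hs, h⟩ := hf.expander.exists_slope hcrit
      refine ⟨s / lam, ?_, fun x y h1 h2 h3 h4 => ?_⟩
      · rcases hs with rfl | rfl
        · left; field_simp
        · right; field_simp
      · rw [div_mul_cancel₀ _ hl0.ne']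
        exact h x (mem x h1 h2) y (mem y h3 h4)
    · -- Such a lap has at most one point, the end point `1`.
      refine ⟨1, Or.inl rfl, fun x y h1 _ h3 _ => ?_⟩
      have hx : (x : ℝ) = 1 := le_antisymm x.2.2 (by nlinarith)
      have hy : (y : ℝ) = 1 := le_antisymm y.2.2 (by nlinarith)
      have : x = y := Subtype.ext (hx.trans hy.symm)
      simp [this]
  choose ε h1 h2 using key
  exact ⟨ε, h1, h2⟩

variable {ε : ℕ → ℝ}

namespace HasLapSigns

/-- A full lap is mapped onto `I`, so one of its end points is mapped to `0` and the other one
to `1`. -/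
theorem full_lap (h : HasLapSigns lam f ε) {k : ℕ} {x y : unitInterval}
    (hx : lam * x = k) (hy : lam * y = k + 1) :
    (ε k = 1 ∧ f x = 0 ∧ f y = 1) ∨ (ε k = -1 ∧ f x = 1 ∧ f y = 0) := by
  have e := h.sub_eq k x y hx.ge (by linarith) (by linarith) hy.le
  have hxy : lam * ((y : ℝ) - x) = 1 := by linarith
  rw [mul_assoc, hxy, mul_one] at e
  have a1 := (f x).2.1
  have a2 := (f x).2.2
  have b1 := (f y).2.1
  have b2 := (f y).2.2
  rcases h.sign k with hk | hk <;> rw [hk] at e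
  · left
    refine ⟨hk, Subtype.ext ?_, Subtype.ext ?_⟩
    · change (f x : ℝ) = 0
      linarith
    · change (f y : ℝ) = 1
      linarith
  · right
    refine ⟨hk, Subtype.ext ?_, Subtype.ext ?_⟩
    · change (f x : ℝ) = 1
      linarith
    · change (f y : ℝ) = 0
      linarith

theorem apply_lap_endpoint (h : HasLapSigns lam f ε) (hl : 1 < lam) {k : ℕ} {x : unitInterval}
    (hx : lam * x = k) : f x = 0 ∨ f x = 1 := by
  have hl0 : 0 < lam := by linarith
  rcases Nat.eq_zero_or_pos k with rfl | hk
  · have hy : lam * (⟨lam⁻¹, by positivity, inv_le_one_of_one_le₀ hl.le⟩ : unitInterval) =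
        (0 : ℕ) + 1 := by
      simp [hl0.ne']
    rcases h.full_lap hx hy with h | h
    · exact Or.inl h.2.1
    · exact Or.inr h.2.1
  · obtain ⟨j, rfl⟩ : ∃ j, k = j + 1 := ⟨k - 1, by omega⟩
    push_cast at hx
    have hj : (j : ℝ) / lam ≤ 1 := by
      rw [div_le_one hl0]
      nlinarith [x.2.2]
    have hy : lam * (⟨j / lam, by positivity, hj⟩ : unitInterval) = (j : ℕ) := by
      simp only
      field_simp
    rcases h.full_lap hy hx with h | h
    · exact Or.inr h.2.2
    · exact Or.inl h.2.2

end HasLapSigns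

/-! ### Discrepancies and their contraction -/

variable {A : Set unitInterval}

theorem measureReal_inter_Iic_eq_integral (hA : MeasurableSet A) (x : unitInterval) :
    volume.real (A ∩ Set.Iic x) =
      ∫ t in (0 : ℝ)..x, A.indicator (1 : unitInterval → ℝ) (Set.projIcc 0 1 zero_le_one t) := by
  have h1 : volume.real (A ∩ Set.Iic x) =
      ∫ y in Set.Iic x, A.indicator (1 : unitInterval → ℝ) y := by
    rw [integral_indicator_one hA, measureReal_restrict_apply hA]
  have h2 := unitInterval.measurePreserving_coe.setIntegral_preimage_emb
    unitInterval.measurableEmbedding_coe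
    (fun t => A.indicator (1 : unitInterval → ℝ) (Set.projIcc 0 1 zero_le_one t)) (Set.Iic (x : ℝ))
  have h3 : Set.Iic (x : ℝ) ∩ unitInterval = Set.Icc 0 (x : ℝ) := by
    ext t
    simp only [Set.mem_inter_iff, Set.mem_Iic, Set.mem_Icc]
    exact ⟨fun h => ⟨h.2.1, h.1⟩, fun h => ⟨h.2, h.1, h.2.trans x.2.2⟩⟩
  rw [Measure.restrict_restrict measurableSet_Iic, h3] at h2
  rw [h1, intervalIntegral.integral_of_le x.2.1, ← integral_Icc_eq_integral_Ioc, ← h2]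
  simp only [Set.projIcc_val]
  rfl

theorem intervalIntegrable_indicator_projIcc (hA : MeasurableSet A) (a b : ℝ) :
    IntervalIntegrable (fun t : ℝ =>
      A.indicator (1 : unitInterval → ℝ) (Set.projIcc 0 1 zero_le_one t)) volume a b := by
  have hm : Measurable (A.indicator (1 : unitInterval → ℝ)) := measurable_one.indicator hA
  refine (intervalIntegrable_const (c := (1 : ℝ))).mono_fun
    (hm.comp continuous_projIcc.measurable).aestronglyMeasurable (Eventually.of_forall fun t => ?_)
  simp only [Set.indicator]
  split_ifs <;> simp

theorem measureReal_inter_Iic_sub (hA : MeasurableSet A) (x y : unitInterval) :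
    volume.real (A ∩ Set.Iic y) - volume.real (A ∩ Set.Iic x) =
      ∫ t in (x : ℝ)..y, A.indicator (1 : unitInterval → ℝ) (Set.projIcc 0 1 zero_le_one t) := by
  rw [measureReal_inter_Iic_eq_integral hA, measureReal_inter_Iic_eq_integral hA,
    intervalIntegral.integral_interval_sub_left] <;>
  exact intervalIntegrable_indicator_projIcc hA _ _

theorem measureReal_inter_Iic_zero (A : Set unitInterval) :
    volume.real (A ∩ Set.Iic 0) = 0 := by
  refine le_antisymm ?_ measureReal_nonneg
  calc volume.real (A ∩ Set.Iic 0) ≤ volume.real (Set.Iic (0 : unitInterval)) :=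
        measureReal_mono Set.inter_subset_right
    _ = 0 := by simp [measureReal_def]

theorem measureReal_inter_Iic_one (A : Set unitInterval) :
    volume.real (A ∩ Set.Iic 1) = volume.real A := by
  rw [Set.inter_eq_left.2 fun y _ => y.2.2]

/-- How far the part of `A` in `[0, x]` is from having its proportional share `x * |A|` of the
Lebesgue measure of `A`. -/
noncomputable def discrepancy (A : Set unitInterval) (x : unitInterval) : ℝ :=
  volume.real (A ∩ Set.Iic x) - x * volume.real A

theorem discrepancy_one (A : Set unitInterval) : discrepancy A 1 = 0 := by
  simp [discrepancy, measureReal_inter_Iic_one]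

theorem abs_discrepancy_le_one (A : Set unitInterval) (x : unitInterval) :
    |discrepancy A x| ≤ 1 := by
  have h1 : volume.real (A ∩ Set.Iic x) ≤ 1 := measureReal_le_one
  have h2 : volume.real A ≤ 1 := measureReal_le_one
  have h3 : 0 ≤ volume.real (A ∩ Set.Iic x) := measureReal_nonneg
  have h4 : 0 ≤ volume.real A := measureReal_nonneg
  have h5 : (x : ℝ) * volume.real A ≤ 1 := mul_le_one₀ x.2.2 h4 h2
  have h6 : 0 ≤ (x : ℝ) * volume.real A := mul_nonneg x.2.1 h4
  rw [discrepancy, abs_le]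
  constructor <;> linarith

namespace HasLapSigns

theorem measureReal_preimage_sub (h : HasLapSigns lam f ε) (hl : 0 < lam) (hf : Measurable f)
    (hA : MeasurableSet A) {k : ℕ} {x y : unitInterval} (hx : k ≤ lam * x)
    (hx' : lam * x ≤ k + 1) (hy : k ≤ lam * y) (hy' : lam * y ≤ k + 1) :
    volume.real (f ⁻¹' A ∩ Set.Iic y) - volume.real (f ⁻¹' A ∩ Set.Iic x) =
      ε k / lam * (volume.real (A ∩ Set.Iic (f y)) - volume.real (A ∩ Set.Iic (f x))) := by
  rw [measureReal_inter_Iic_sub (hf hA), measureReal_inter_Iic_sub hA]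
  have hε : ε k * ε k = 1 := by rcases h.sign k with h | h <;> rw [h] <;> norm_num
  have hε0 : ε k ≠ 0 := left_ne_zero_of_mul_eq_one hε
  let u : ℝ → ℝ := fun t => A.indicator (1 : unitInterval → ℝ) (Set.projIcc 0 1 zero_le_one t)
  have e1 : ∫ t in (x : ℝ)..y,
        (f ⁻¹' A).indicator (1 : unitInterval → ℝ) (Set.projIcc 0 1 zero_le_one t) =
      ∫ t in (x : ℝ)..y, u (ε k * lam * t + (f x - ε k * lam * x)) := by
    refine intervalIntegral.integral_congr fun t ht => ?_
    have ht0 : 0 ≤ t := (le_min x.2.1 y.2.1).trans ht.1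
    have ht1 : t ≤ 1 := ht.2.trans (max_le x.2.2 y.2.2)
    have hk : k ≤ lam * t := by
      rcases min_choice (x : ℝ) y with hm | hm <;> have := ht.1 <;> rw [hm] at this <;> nlinarith
    have hk' : lam * t ≤ k + 1 := by
      rcases max_choice (x : ℝ) y with hm | hm <;> have := ht.2 <;> rw [hm] at this <;> nlinarith
    have e := h.sub_eq k x ⟨t, ht0, ht1⟩ hx hx' hk hk'
    have e' : ε k * lam * t + (f x - ε k * lam * x) = f ⟨t, ht0, ht1⟩ := by
      simp only at e
      linarith
    simp only [u]
    rw [e', Set.projIcc_val, Set.projIcc_of_mem zero_le_one ⟨ht0, ht1⟩]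
    rfl
  have e2 := h.sub_eq k x y hx hx' hy hy'
  rw [e1, intervalIntegral.integral_comp_mul_add u (mul_ne_zero hε0 hl.ne'),
    show ε k * lam * x + (f x - ε k * lam * x) = f x by ring,
    show ε k * lam * y + (f x - ε k * lam * x) = f y by linarith, smul_eq_mul]
  congr 1
  rw [mul_inv, ← eq_inv_of_mul_eq_one_left hε, div_eq_mul_inv]

theorem measureReal_preimage_lap_endpoint (h : HasLapSigns lam f ε) (hl : 0 < lam)
    (hf : Measurable f) (hA : MeasurableSet A) {k : ℕ} :
    ∀ {x : unitInterval}, lam * x = k →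
      volume.real (f ⁻¹' A ∩ Set.Iic x) = x * volume.real A := by
  induction k with
  | zero =>
    intro x hx
    have : x = 0 := Subtype.ext (by simpa [hl.ne'] using hx)
    rw [this, measureReal_inter_Iic_zero]
    simp
  | succ k ih =>
    intro x hx
    push_cast at hx
    have hj : (k : ℝ) / lam ≤ 1 := by
      rw [div_le_one hl]
      nlinarith [x.2.2]
    let y : unitInterval := ⟨k / lam, by positivity, hj⟩
    have hy : lam * (y : ℝ) = k := by
      simp only [y]
      field_simp
    have e := h.measureReal_preimage_sub hl hf hA (k := k) (x := y) (y := x) hy.ge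
      (by linarith) (by linarith) hx.le
    have hxy : (x : ℝ) - y = 1 / lam := by
      rw [eq_div_iff hl.ne']
      linarith
    have e' : (x : ℝ) * volume.real A = y * volume.real A + 1 / lam * volume.real A := by
      rw [← hxy]
      ring
    rw [ih hy] at e
    rcases h.full_lap hy hx with ⟨h1, h2, h3⟩ | ⟨h1, h2, h3⟩ <;>
    rw [h1, h2, h3, measureReal_inter_Iic_zero, measureReal_inter_Iic_one] at e <;>
    rw [e', ← sub_eq_iff_eq_add', e] <;> ring

/-- The change of variables formula. The full laps to the left of `x` contribute exactly their share
of the measure of `A`, so that the error comes from the lap of `x` alone. -/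
theorem measureReal_preimage_inter_Iic (h : HasLapSigns lam f ε) (hl : 1 < lam)
    (hf : Measurable f) (hA : MeasurableSet A) (x : unitInterval) :
    volume.real (f ⁻¹' A ∩ Set.Iic x) =
      x * volume.real A + ε ⌊lam * x⌋₊ / lam * discrepancy A (f x) := by
  have hl0 : 0 < lam := by linarith
  have hx0 : 0 ≤ lam * x := mul_nonneg hl0.le x.2.1
  set k := ⌊lam * x⌋₊ with hk
  have hk1 : (k : ℝ) ≤ lam * x := Nat.floor_le hx0
  have hk2 : lam * x ≤ k + 1 := (Nat.lt_floor_add_one _).le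
  have hj : (k : ℝ) / lam ≤ 1 := by
    rw [div_le_one hl0]
    nlinarith [x.2.2]
  let y : unitInterval := ⟨k / lam, by positivity, hj⟩
  have hy : lam * (y : ℝ) = k := by
    simp only [y]
    field_simp
  have e := h.measureReal_preimage_sub hl0 hf hA (k := k) (x := y) (y := x) hy.ge
    (by linarith) hk1 hk2
  have e' := h.sub_eq k y x hy.ge (by linarith) hk1 hk2
  rw [h.measureReal_preimage_lap_endpoint hl0 hf hA hy] at e
  have hfy : volume.real (A ∩ Set.Iic (f y)) = f y * volume.real A := by
    rcases h.apply_lap_endpoint hl hy with h0 | h0 <;> rw [h0]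
    · simp [measureReal_inter_Iic_zero]
    · simp [measureReal_inter_Iic_one]
  rw [hfy] at e
  have hε : ε k * ε k = 1 := by rcases h.sign k with h | h <;> rw [h] <;> norm_num
  have e2 : (x : ℝ) - y = ε k / lam * (f x - f y) := by
    rw [e', show ε k / lam * (ε k * lam * ((x : ℝ) - y)) =
      (ε k * ε k) * (lam / lam) * ((x : ℝ) - y) by ring, hε, div_self hl0.ne']
    ring
  have e3 : (x : ℝ) * volume.real A =
      y * volume.real A + ε k / lam * (f x - f y) * volume.real A := by
    rw [← e2]
    ring
  rw [discrepancy]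
  linear_combination e - e3

theorem discrepancy_preimage (h : HasLapSigns lam f ε) (hl : 1 < lam)
    (hf : Measurable f) (hA : MeasurableSet A) (x : unitInterval) :
    discrepancy (f ⁻¹' A) x = ε ⌊lam * x⌋₊ / lam * discrepancy A (f x) -
      x * (ε ⌊lam * (1 : unitInterval)⌋₊ / lam * discrepancy A (f 1)) := by
  have h1 := h.measureReal_preimage_inter_Iic hl hf hA x
  have h2 := h.measureReal_preimage_inter_Iic hl hf hA 1
  rw [measureReal_inter_Iic_one] at h2
  rw [discrepancy, h1, h2, Set.Icc.coe_one]
  ring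

theorem abs_sign (h : HasLapSigns lam f ε) (k : ℕ) : |ε k| = 1 := by
  rcases h.sign k with h | h <;> rw [h] <;> norm_num

theorem abs_discrepancy_preimage_le (h : HasLapSigns lam f ε) (hl : 1 < lam)
    (hf : Measurable f) (hA : MeasurableSet A) {C : ℝ} (hC : ∀ x, |discrepancy A x| ≤ C)
    (x : unitInterval) : |discrepancy (f ⁻¹' A) x| ≤ 2 / lam * C := by
  have hl0 : 0 < lam := by linarith
  rw [h.discrepancy_preimage hl hf hA]
  refine (abs_sub _ _).trans ?_
  rw [abs_mul, abs_mul, abs_mul, abs_div, abs_div, h.abs_sign, h.abs_sign, abs_of_pos hl0,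
    abs_of_nonneg x.2.1]
  have h1 : 1 / lam * |discrepancy A (f x)| ≤ 1 / lam * C := by gcongr; exact hC _
  have h2 : 1 / lam * |discrepancy A (f 1)| ≤ 1 / lam * C := by gcongr; exact hC _
  have h3 : (x : ℝ) * (1 / lam * |discrepancy A (f 1)|) ≤ 1 / lam * |discrepancy A (f 1)| :=
    mul_le_of_le_one_left (by positivity) x.2.2
  calc _ ≤ 1 / lam * C + 1 / lam * C := by linarith
    _ = 2 / lam * C := by ring

theorem abs_discrepancy_iterate_le (h : HasLapSigns lam f ε) (hl : 1 < lam)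
    (hf : Measurable f) (hA : MeasurableSet A) (n : ℕ) :
    ∀ x, |discrepancy (f^[n] ⁻¹' A) x| ≤ (2 / lam) ^ n := by
  induction n with
  | zero => simpa using abs_discrepancy_le_one A
  | succ n ih =>
    intro x
    rw [Function.iterate_succ, Set.preimage_comp, pow_succ']
    exact h.abs_discrepancy_preimage_le hl hf (hf.iterate n hA) ih x

theorem tendsto_discrepancy_iterate (h : HasLapSigns lam f ε) (hl : 2 < lam)
    (hf : Measurable f) (hA : MeasurableSet A) (x : unitInterval) :
    Tendsto (fun n => discrepancy (f^[n] ⁻¹' A) x) atTop (𝓝 0) := by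
  refine squeeze_zero_norm (a := fun n => (2 / lam) ^ n)
    (fun n => h.abs_discrepancy_iterate_le (by linarith) hf hA n x)
    (tendsto_pow_atTop_nhds_zero_of_lt_one (by positivity) ((div_lt_one (by linarith)).2 hl))

end HasLapSigns

/-! ### Equidistribution -/

/-- Sets whose discrepancies tend to `0` on initial intervals get equidistributed in every
measurable set, since initial intervals generate the Borel sets. -/
theorem tendsto_measureReal_inter_sub {C : ℕ → Set unitInterval} (hC : ∀ n, MeasurableSet (C n))
    (h : ∀ x, Tendsto (fun n => discrepancy (C n) x) atTop (𝓝 0)) {B : Set unitInterval}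
    (hB : MeasurableSet B) :
    Tendsto (fun n => volume.real (C n ∩ B) - volume.real (C n) * volume.real B) atTop (𝓝 0) := by
  have hgen : (inferInstance : MeasurableSpace unitInterval) =
      MeasurableSpace.generateFrom (Set.range Set.Iic) :=
    (BorelSpace.measurable_eq).trans (borel_eq_generateFrom_Iic unitInterval)
  refine MeasurableSpace.induction_on_inter (C := fun B _ => Tendsto
    (fun n => volume.real (C n ∩ B) - volume.real (C n) * volume.real B) atTop (𝓝 0))
    hgen isPiSystem_Iic ?_ ?_ ?_ ?_ B hB
  · simp
  · rintro _ ⟨x, rfl⟩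
    refine (h x).congr fun n => ?_
    have : volume.real (Set.Iic x) = x := by
      rw [measureReal_def, unitInterval.volume_Iic, ENNReal.toReal_ofReal x.2.1]
    rw [this, discrepancy, mul_comm (x : ℝ)]
  · intro B hB ih
    have := ih.neg
    rw [neg_zero] at this
    refine this.congr fun n => ?_
    have h1 := measureReal_inter_add_sdiff (μ := volume) (s := C n) hB
    rw [measureReal_compl hB, probReal_univ, ← Set.sdiff_eq]
    linear_combination -h1
  · intro D hD hDm ih
    have hsum : ∀ μ : Measure unitInterval, IsFiniteMeasure μ → ∀ E : ℕ → Set unitInterval,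
        (∀ i, MeasurableSet (E i)) → Pairwise (Function.onFun Disjoint E) →
        HasSum (fun i => μ.real (E i)) (μ.real (⋃ i, E i)) := by
      intro μ hμ E hE hd
      have h1 : ∑' i, μ (E i) ≠ ⊤ := by
        rw [← measure_iUnion hd hE]
        exact measure_ne_top _ _
      simp only [measureReal_def]
      rw [measure_iUnion hd hE, ENNReal.tsum_toReal_eq fun i => measure_ne_top _ _]
      exact (ENNReal.summable_toReal h1).hasSum
    have hD1 := hsum volume inferInstance D hDm hD
    have hD2 : ∀ n, HasSum (fun i => volume.real (C n ∩ D i)) (volume.real (C n ∩ ⋃ i, D i)) := by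
      intro n
      rw [Set.inter_iUnion]
      exact hsum volume inferInstance _ (fun i => (hC n).inter (hDm i))
        fun i j hij => (hD hij).mono Set.inter_subset_right Set.inter_subset_right
    have key := tendsto_tsum_of_dominated_convergence (𝓕 := atTop)
      (f := fun n i => volume.real (C n ∩ D i) - volume.real (C n) * volume.real (D i))
      (g := fun _ => 0) (bound := fun i => volume.real (D i)) hD1.summable ih
      (Eventually.of_forall fun n i => by
        have h1 : volume.real (C n ∩ D i) ≤ volume.real (D i) :=
          measureReal_mono Set.inter_subset_right
        have h2 : volume.real (C n) * volume.real (D i) ≤ volume.real (D i) :=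
          mul_le_of_le_one_left measureReal_nonneg measureReal_le_one
        have h3 : 0 ≤ volume.real (C n ∩ D i) := measureReal_nonneg
        have h4 : 0 ≤ volume.real (C n) * volume.real (D i) := by positivity
        rw [Real.norm_eq_abs, abs_le]
        constructor <;> linarith)
    rw [tsum_zero] at key
    refine key.congr fun n => ?_
    exact ((hD2 n).sub (hD1.mul_left _)).tsum_eq

theorem tendsto_setIntegral_sub {C : ℕ → Set unitInterval} (hC : ∀ n, MeasurableSet (C n))
    (h : ∀ x, Tendsto (fun n => discrepancy (C n) x) atTop (𝓝 0)) {g : unitInterval → ℝ}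
    (hg : Integrable g) :
    Tendsto (fun n => (∫ y in C n, g y) - volume.real (C n) * ∫ y, g y) atTop (𝓝 0) := by
  refine Integrable.induction (P := fun g : unitInterval → ℝ => Tendsto
    (fun n => (∫ y in C n, g y) - volume.real (C n) * ∫ y, g y) atTop (𝓝 0)) ?_ ?_ ?_ ?_ hg
  · intro c B hB _
    have := (tendsto_measureReal_inter_sub hC h hB).mul_const c
    rw [zero_mul] at this
    refine this.congr fun n => ?_
    rw [integral_indicator_const c hB, integral_indicator_const c hB,
      measureReal_restrict_apply hB, Set.inter_comm, smul_eq_mul, smul_eq_mul]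
    ring
  · intro u v _ hu hv ihu ihv
    have := ihu.add ihv
    rw [add_zero] at this
    refine this.congr fun n => ?_
    simp only [Pi.add_apply]
    rw [integral_add hu hv, integral_add hu.integrableOn hv.integrableOn]
    ring
  · -- Closedness in `L¹`: both functionals of `g` are bounded by the `L¹` norm, uniformly in `n`.
    refine isClosed_of_closure_subset fun u hu => ?_
    refine Metric.tendsto_atTop.2 fun δ hδ => ?_
    obtain ⟨v, hv, huv⟩ := Metric.mem_closure_iff.1 hu (δ / 4) (by linarith)
    obtain ⟨N, hN⟩ := Metric.tendsto_atTop.1 (hv : Tendsto _ _ _) (δ / 2) (by linarith)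
    refine ⟨N, fun n hn => ?_⟩
    have hn' := hN n hn
    rw [Real.dist_0_eq_abs] at hn' ⊢
    have hui : Integrable u := L1.integrable_coeFn u
    have hvi : Integrable v := L1.integrable_coeFn v
    have hw : Integrable (fun y => |u y - v y|) := (hui.sub hvi).abs
    have hd : ∫ y, |u y - v y| < δ / 4 := by
      rw [dist_eq_norm, L1.norm_eq_integral_norm] at huv
      refine lt_of_eq_of_lt (integral_congr_ae ?_) huv
      filter_upwards [Lp.coeFn_sub u v] with y hy
      rw [hy, Pi.sub_apply, Real.norm_eq_abs]
    have h1 : |(∫ y in C n, u y) - ∫ y in C n, v y| ≤ ∫ y, |u y - v y| := by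
      rw [← integral_sub hui.integrableOn hvi.integrableOn]
      exact (abs_integral_le_integral_abs).trans
        (setIntegral_le_integral hw (Eventually.of_forall fun y => abs_nonneg _))
    have h2 : |(∫ y, u y) - ∫ y, v y| ≤ ∫ y, |u y - v y| := by
      rw [← integral_sub hui hvi]
      exact abs_integral_le_integral_abs
    have h3 : |volume.real (C n) * ((∫ y, u y) - ∫ y, v y)| ≤ ∫ y, |u y - v y| := by
      rw [abs_mul, abs_of_nonneg measureReal_nonneg]
      exact (mul_le_of_le_one_left (abs_nonneg _) measureReal_le_one).trans h2
    rw [abs_lt] at hn' ⊢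
    rw [abs_le] at h1 h3
    rw [mul_sub] at h3
    constructor <;> linarith [hn'.1, hn'.2, h1.1, h1.2, h3.1, h3.2]
  · intro u v huv _ ih
    refine ih.congr fun n => ?_
    rw [integral_congr_ae huv, integral_congr_ae (ae_restrict_of_ae huv)]

/-- Sets whose discrepancies tend to `0` get equidistributed for every absolutely continuous finite
measure. -/
theorem tendsto_measureReal_sub {C : ℕ → Set unitInterval} (hC : ∀ n, MeasurableSet (C n))
    (h : ∀ x, Tendsto (fun n => discrepancy (C n) x) atTop (𝓝 0)) (ρ : Measure unitInterval)
    [IsFiniteMeasure ρ] (hρ : ρ ≪ volume) :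
    Tendsto (fun n => ρ.real (C n) - volume.real (C n) * ρ.real Set.univ) atTop (𝓝 0) := by
  refine (tendsto_setIntegral_sub hC h
    (Measure.integrable_toReal_rnDeriv (μ := ρ) (ν := volume))).congr fun n => ?_
  rw [Measure.setIntegral_toReal_rnDeriv hρ, ← setIntegral_univ,
    Measure.setIntegral_toReal_rnDeriv hρ]

/-! ### The invariant density -/

/-- The product of the reciprocals `ε k / lam` of the slopes of the first `n` laps that the orbit of
`1` visits. A point `x` is assigned to the lap with index `⌊lam * x⌋₊`, that is, a common end point
of two laps to the one on its right. -/
noncomputable def orbitWeight (lam : ℝ) (f : unitInterval → unitInterval) (ε : ℕ → ℝ)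
    (n : ℕ) : ℝ :=
  ∏ j ∈ Finset.range n, ε ⌊lam * (f^[j] 1 : unitInterval)⌋₊ / lam

/-- The (not normalized) invariant density: a sum of multiples of the indicator functions of the
intervals `[0, f^n 1]`. -/
noncomputable def invariantDensity (lam : ℝ) (f : unitInterval → unitInterval) (ε : ℕ → ℝ)
    (y : unitInterval) : ℝ :=
  ∑' n, (Set.Iic (f^[n] 1)).indicator (fun _ => orbitWeight lam f ε n) y

theorem summable_inv_pow (hl : 1 < lam) : Summable fun n : ℕ => lam⁻¹ ^ n :=
  summable_geometric_of_lt_one (by positivity) (inv_lt_one_of_one_lt₀ hl)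

theorem measurable_invariantDensity : Measurable (invariantDensity lam f ε) :=
  Measurable.tsum fun _ => measurable_const.indicator measurableSet_Iic

namespace HasLapSigns

theorem abs_orbitWeight (h : HasLapSigns lam f ε) (hl : 0 < lam) (n : ℕ) :
    |orbitWeight lam f ε n| = lam⁻¹ ^ n := by
  simp [orbitWeight, Finset.abs_prod, abs_div, h.abs_sign, abs_of_pos hl]

theorem norm_indicator_orbitWeight_le (h : HasLapSigns lam f ε) (hl : 0 < lam) (n : ℕ)
    (y : unitInterval) :
    ‖(Set.Iic (f^[n] 1)).indicator (fun _ => orbitWeight lam f ε n) y‖ ≤ lam⁻¹ ^ n :=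
  (norm_indicator_le_norm_self _ _).trans (h.abs_orbitWeight hl n).le

/-- The term `n = 0` of the density is `1`, and the others add up to at most `1 / (lam - 1) < 1` in
absolute value. -/
theorem abs_invariantDensity_sub_one_le (h : HasLapSigns lam f ε) (hl : 1 < lam)
    (y : unitInterval) : |invariantDensity lam f ε y - 1| ≤ 1 / (lam - 1) := by
  have hl0 : 0 < lam := by linarith
  have hs := (summable_inv_pow hl).of_norm_bounded
    (fun n => h.norm_indicator_orbitWeight_le hl0 n y)
  have h1 := hs.sum_add_tsum_nat_add 1
  have h0 : (Set.Iic (f^[0] 1)).indicator (fun _ => orbitWeight lam f ε 0) y = 1 := by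
    rw [Set.indicator_of_mem (show y ∈ Set.Iic (f^[0] 1) from y.2.2)]
    simp [orbitWeight]
  rw [Finset.sum_range_one, h0] at h1
  have hg : HasSum (fun n : ℕ => lam⁻¹ ^ (n + 1)) (1 / (lam - 1)) := by
    have := (hasSum_geometric_of_lt_one (r := lam⁻¹) (by positivity)
      (inv_lt_one_of_one_lt₀ hl)).mul_left lam⁻¹
    have e : lam⁻¹ * (1 - lam⁻¹)⁻¹ = 1 / (lam - 1) := by
      have : lam - 1 ≠ 0 := by linarith
      rw [← mul_inv, mul_sub, mul_one, mul_inv_cancel₀ hl0.ne', one_div]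
    rw [e] at this
    simpa only [pow_succ'] using this
  rw [invariantDensity, ← h1, add_sub_cancel_left]
  exact tsum_of_norm_bounded hg fun n => h.norm_indicator_orbitWeight_le hl0 (n + 1) y

theorem invariantDensity_pos (h : HasLapSigns lam f ε) (hl : 2 < lam) (y : unitInterval) :
    0 < invariantDensity lam f ε y := by
  have h1 := (abs_le.1 (h.abs_invariantDensity_sub_one_le (by linarith) y)).1
  have h2 : 1 / (lam - 1) < 1 := by
    rw [div_lt_one (by linarith)]
    linarith
  linarith

theorem integrable_invariantDensity (h : HasLapSigns lam f ε) (hl : 1 < lam) :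
    Integrable (invariantDensity lam f ε) := by
  refine Integrable.of_bound measurable_invariantDensity.aestronglyMeasurable
    (1 / (lam - 1) + 1) (Eventually.of_forall fun y => ?_)
  have h1 := abs_le.1 (h.abs_invariantDensity_sub_one_le hl y)
  have h2 : 0 < 1 / (lam - 1) := one_div_pos.2 (by linarith)
  rw [Real.norm_eq_abs, abs_le]
  constructor <;> linarith [h1.1, h1.2]

theorem hasSum_setIntegral_invariantDensity (h : HasLapSigns lam f ε) (hl : 1 < lam)
    (A : Set unitInterval) :
    HasSum (fun n => orbitWeight lam f ε n * volume.real (A ∩ Set.Iic (f^[n] 1)))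
      (∫ y in A, invariantDensity lam f ε y) := by
  have hl0 : 0 < lam := by linarith
  have key := hasSum_integral_of_summable_integral_norm (μ := volume.restrict A)
    (F := fun n => (Set.Iic (f^[n] 1)).indicator (fun _ => orbitWeight lam f ε n))
    (fun n => (integrable_const _).indicator measurableSet_Iic)
    ((summable_inv_pow hl).of_nonneg_of_le (fun n => integral_nonneg fun y => norm_nonneg _)
      fun n => ?_)
  · convert! key using 2 with n
    rw [integral_indicator_const _ measurableSet_Iic, measureReal_restrict_apply measurableSet_Iic,
      Set.inter_comm, smul_eq_mul, mul_comm]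
  · have h1 := norm_integral_le_of_norm_le_const (μ := volume.restrict A)
      (f := fun y => ‖(Set.Iic (f^[n] 1)).indicator (fun _ => orbitWeight lam f ε n) y‖)
      (C := lam⁻¹ ^ n) (Eventually.of_forall fun y => by
        rw [norm_norm]
        exact h.norm_indicator_orbitWeight_le hl0 n y)
    refine (le_abs_self _).trans (h1.trans (mul_le_of_le_one_right (by positivity) ?_))
    rw [measureReal_restrict_apply MeasurableSet.univ]
    exact measureReal_le_one

/-- Invariance of the density. By the change of variables formula the `n`-th term of the sum for
`f ⁻¹' A` is its mean part plus the discrepancy part of the `n + 1`-st term of the sum for `A`;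
the discrepancy part of the term `n = 0` vanishes. -/
theorem setIntegral_invariantDensity_preimage (h : HasLapSigns lam f ε) (hl : 1 < lam)
    (hf : Measurable f) (hA : MeasurableSet A) :
    ∫ y in f ⁻¹' A, invariantDensity lam f ε y = ∫ y in A, invariantDensity lam f ε y := by
  have hl0 : 0 < lam := by linarith
  have h1 := h.hasSum_setIntegral_invariantDensity hl A
  have h2 := h.hasSum_setIntegral_invariantDensity hl (f ⁻¹' A)
  let w := orbitWeight lam f ε
  let x : ℕ → unitInterval := fun n => f^[n] 1
  have hs1 : Summable fun n => w n * x n * volume.real A := by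
    refine (summable_inv_pow hl).of_norm_bounded fun n => ?_
    rw [norm_mul, norm_mul, Real.norm_eq_abs, Real.norm_eq_abs, Real.norm_eq_abs,
      h.abs_orbitWeight hl0, abs_of_nonneg (x n).2.1, abs_of_nonneg measureReal_nonneg]
    exact mul_le_of_le_one_right (by have := (x n).2.1; positivity) measureReal_le_one |>.trans
      (mul_le_of_le_one_right (by positivity) (x n).2.2)
  have hs2 : Summable fun n => w n * discrepancy A (x n) := by
    refine (summable_inv_pow hl).of_norm_bounded fun n => ?_
    rw [norm_mul, Real.norm_eq_abs, Real.norm_eq_abs, h.abs_orbitWeight hl0]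
    exact mul_le_of_le_one_right (by positivity) (abs_discrepancy_le_one _ _)
  have hs3 := hs2.hasSum
  rw [← hasSum_nat_add_iff' 1, Finset.sum_range_one] at hs3
  have hx0 : discrepancy A (x 0) = 0 := discrepancy_one A
  rw [hx0, mul_zero, sub_zero] at hs3
  have e1 : (fun n => w n * volume.real (A ∩ Set.Iic (f^[n] 1))) =
      fun n => w n * x n * volume.real A + w n * discrepancy A (x n) := by
    funext n
    simp only [discrepancy, x]
    ring
  have e2 : (fun n => w n * volume.real (f ⁻¹' A ∩ Set.Iic (f^[n] 1))) =
      fun n => w n * x n * volume.real A + w (n + 1) * discrepancy A (x (n + 1)) := by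
    funext n
    rw [h.measureReal_preimage_inter_Iic hl hf hA]
    simp only [w, x, orbitWeight, Finset.prod_range_succ, Function.iterate_succ_apply']
    ring
  have r1 := h1.unique (e1 ▸ hs1.hasSum.add hs2.hasSum)
  have r2 := h2.unique (e2 ▸ hs1.hasSum.add hs3)
  rw [r1, r2]

/-- The absolutely continuous invariant probability measure. -/
theorem exists_invariant_measure (h : HasLapSigns lam f ε) (hl : 2 < lam) (hf : Measurable f) :
    ∃ ν : Measure unitInterval, IsProbabilityMeasure ν ∧ ν ≪ volume ∧
      (volume : Measure unitInterval) ≪ ν ∧ MeasurePreserving f ν ν := by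
  have hl1 : 1 < lam := by linarith
  let d : unitInterval → ENNReal := fun y => ENNReal.ofReal (invariantDensity lam f ε y)
  let μ : Measure unitInterval := volume.withDensity d
  have hμ : ∀ A, MeasurableSet A →
      μ A = ENNReal.ofReal (∫ y in A, invariantDensity lam f ε y) := fun A hA => by
    rw [withDensity_apply _ hA, ofReal_integral_eq_lintegral_ofReal
      (h.integrable_invariantDensity hl1).integrableOn
      (Eventually.of_forall fun y => (h.invariantDensity_pos hl y).le)]
  have hac : (volume : Measure unitInterval) ≪ μ :=
    withDensity_absolutelyContinuous' measurable_invariantDensity.ennreal_ofReal.aemeasurable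
      (Eventually.of_forall fun y => (ENNReal.ofReal_pos.2 (h.invariantDensity_pos hl y)).ne')
  have hfin : IsFiniteMeasure μ := ⟨by
    rw [hμ _ MeasurableSet.univ]
    exact ENNReal.ofReal_lt_top⟩
  have hne : NeZero μ := ⟨fun h0 => by
    have := hac (s := Set.univ) (by rw [h0]; rfl)
    simp at this⟩
  have hpres : MeasurePreserving f μ μ := by
    refine ⟨hf, Measure.ext fun A hA => ?_⟩
    rw [Measure.map_apply hf hA, hμ _ (hf hA), hμ _ hA,
      h.setIntegral_invariantDensity_preimage hl1 hf hA]
  exact ⟨(μ Set.univ)⁻¹ • μ, isProbabilityMeasureSMul,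
    Measure.smul_absolutelyContinuous.trans (withDensity_absolutelyContinuous _ _),
    hac.trans (Measure.absolutelyContinuous_smul (ENNReal.inv_ne_zero.2 (measure_ne_top _ _))),
    hpres.smul_measure _⟩

end HasLapSigns

/-! ### Mixing -/

namespace HasLapSigns

theorem tendsto_volume_preimage_iterate (h : HasLapSigns lam f ε) (hl : 2 < lam)
    {ν : Measure unitInterval} [IsProbabilityMeasure ν] (hν : ν ≪ volume)
    (hpres : MeasurePreserving f ν ν) (hA : MeasurableSet A) :
    Tendsto (fun n => volume.real (f^[n] ⁻¹' A)) atTop (𝓝 (ν.real A)) := by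
  have hf := hpres.measurable
  have key := tendsto_measureReal_sub (fun n => hf.iterate n hA)
    (h.tendsto_discrepancy_iterate hl hf hA) ν hν
  have := (tendsto_const_nhds (x := ν.real A)).sub key
  rw [sub_zero] at this
  refine this.congr fun n => ?_
  rw [(hpres.iterate n).measureReal_preimage hA.nullMeasurableSet, probReal_univ]
  ring

theorem tendsto_measureReal_preimage_iterate_inter (h : HasLapSigns lam f ε) (hl : 2 < lam)
    {ν : Measure unitInterval} [IsProbabilityMeasure ν] (hν : ν ≪ volume)
    (hpres : MeasurePreserving f ν ν) (hA : MeasurableSet A) (B : Set unitInterval) :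
    Tendsto (fun n => ν.real (f^[n] ⁻¹' A ∩ B)) atTop (𝓝 (ν.real A * ν.real B)) := by
  have hf := hpres.measurable
  have key := tendsto_measureReal_sub (fun n => hf.iterate n hA)
    (h.tendsto_discrepancy_iterate hl hf hA) (ν.restrict B)
    (Measure.restrict_le_self.absolutelyContinuous.trans hν)
  have := key.add ((h.tendsto_volume_preimage_iterate hl hν hpres hA).mul_const (ν.real B))
  rw [zero_add] at this
  refine this.congr fun n => ?_
  rw [measureReal_restrict_apply (hf.iterate n hA), measureReal_restrict_apply MeasurableSet.univ,
    Set.univ_inter]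
  ring

end HasLapSigns

theorem hasDensityZero_empty : HasDensityZero ∅ := by
  simp [HasDensityZero]

theorem IsZigZag.exists_isWeakMixing (hf : IsZigZag lam f) (hl : 2 < lam) :
    ∃ ν : Measure unitInterval, ν ≪ volume ∧ (volume : Measure unitInterval) ≪ ν ∧
      IsWeakMixing f ν ∧ ∀ ν' : Measure unitInterval, IsProbabilityMeasure ν' → ν' ≪ volume →
        MeasurePreserving f ν' ν' → ν' = ν := by
  obtain ⟨ε, h⟩ := hf.exists_hasLapSigns
  obtain ⟨ν, hν, h1, h2, h3⟩ := h.exists_invariant_measure hl hf.expander.continuous.measurable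
  refine ⟨ν, h1, h2, ⟨hν, h3, fun A B hA _ => ⟨∅, hasDensityZero_empty, ?_⟩⟩, ?_⟩
  · exact (h.tendsto_measureReal_preimage_iterate_inter hl h1 h3 hA B).mono_left inf_le_left
  · intro ν' hν' h1' h3'
    refine Measure.ext fun A hA => ?_
    exact (measureReal_eq_measureReal_iff).1 (tendsto_nhds_unique
      (h.tendsto_volume_preimage_iterate hl h1' h3' hA)
      (h.tendsto_volume_preimage_iterate hl h1 h3 hA))

/-! ### Expansion of intervals -/

namespace HasLapSigns

theorem abs_apply_sub (h : HasLapSigns lam f ε) (hl : 0 < lam) {k : ℕ} {x y : unitInterval}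
    (hx : k ≤ lam * x) (hy : lam * y ≤ k + 1) (hxy : x ≤ y) :
    |(f y : ℝ) - f x| = lam * ((y : ℝ) - x) := by
  have hxy' : (x : ℝ) ≤ y := hxy
  rw [h.sub_eq k x y hx (by nlinarith) (by nlinarith) hy, abs_mul, abs_mul, h.abs_sign,
    abs_of_pos hl, abs_of_nonneg (sub_nonneg.2 hxy'), one_mul]

theorem injOn_Icc (h : HasLapSigns lam f ε) (hl : 0 < lam) {k : ℕ} {x y : unitInterval}
    (hx : k ≤ lam * x) (hy : lam * y ≤ k + 1) : Set.InjOn f (Set.Icc x y) := by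
  have key : ∀ u ∈ Set.Icc x y, ∀ v ∈ Set.Icc x y, u ≤ v → f u = f v → u = v := by
    intro u hu v hv huv he
    have hu' : (x : ℝ) ≤ u := hu.1
    have hv' : (v : ℝ) ≤ y := hv.2
    have := h.abs_apply_sub hl (by nlinarith) (by nlinarith) huv
    rw [he, sub_self, abs_zero] at this
    have h0 := (mul_eq_zero.1 this.symm).resolve_left hl.ne'
    exact Subtype.ext (by linarith)
  intro u hu v hv he
  rcases le_total u v with huv | huv
  · exact key u hu v hv huv he
  · exact (key v hv u hu huv he.symm).symm

theorem image_Icc (h : HasLapSigns lam f ε) (hl : 0 < lam) (hf : Continuous f) {k : ℕ}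
    {x y : unitInterval} (hx : k ≤ lam * x) (hy : lam * y ≤ k + 1) (hxy : x ≤ y) :
    f '' Set.Icc x y = Set.uIcc (f x) (f y) := by
  refine Set.Subset.antisymm ?_ ?_
  · rintro _ ⟨z, hz, rfl⟩
    have hxz : (x : ℝ) ≤ z := hz.1
    have hzy : (z : ℝ) ≤ y := hz.2
    have e1 := h.sub_eq k x z hx (by nlinarith) (by nlinarith) (by nlinarith)
    have e2 := h.sub_eq k z y (by nlinarith) (by nlinarith) (by nlinarith) (by nlinarith)
    have p1 : 0 ≤ lam * ((z : ℝ) - x) := mul_nonneg hl.le (by linarith)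
    have p2 : 0 ≤ lam * ((y : ℝ) - z) := mul_nonneg hl.le (by linarith)
    rw [Set.mem_uIcc]
    rcases h.sign k with hk | hk <;> rw [hk] at e1 e2
    · left
      exact ⟨show (f x : ℝ) ≤ f z by linarith, show (f z : ℝ) ≤ f y by linarith⟩
    · right
      exact ⟨show (f y : ℝ) ≤ f z by linarith, show (f z : ℝ) ≤ f x by linarith⟩
  · have := intermediate_value_uIcc (a := x) (b := y) hf.continuousOn
    rwa [Set.uIcc_of_le hxy] at this

theorem image_full_lap (h : HasLapSigns lam f ε) (hl : 0 < lam) (hf : Continuous f) {k : ℕ}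
    {x y : unitInterval} (hx : lam * x = k) (hy : lam * y = k + 1) :
    f '' Set.Icc x y = Set.univ := by
  have hxy : x ≤ y := show (x : ℝ) ≤ y by nlinarith
  rw [h.image_Icc hl hf hx.ge hy.le hxy, Set.eq_univ_iff_forall]
  intro z
  rcases h.full_lap hx hy with ⟨-, h1, h2⟩ | ⟨-, h1, h2⟩ <;> rw [h1, h2, Set.mem_uIcc]
  · exact Or.inl ⟨z.2.1, z.2.2⟩
  · exact Or.inr ⟨z.2.1, z.2.2⟩

theorem surjective (h : HasLapSigns lam f ε) (hl : 1 < lam) (hf : Continuous f) :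
    Function.Surjective f := by
  have hy : lam * (⟨lam⁻¹, by positivity, inv_le_one_of_one_le₀ hl.le⟩ : unitInterval) =
      (0 : ℕ) + 1 := by
    simp [(by linarith : lam ≠ 0)]
  have := h.image_full_lap (x := 0) (by linarith) hf (by simp) hy
  exact fun z => (this.ge (Set.mem_univ z)).imp fun _ h => h.2

/-- The image of an interval is all of `I` or contains an interval that is longer by the factor
`lam / 2`: an interval that contains no full lap is covered by two laps, and one of them contains at
least half of it. -/
theorem image_eq_univ_or_exists_Icc_subset (h : HasLapSigns lam f ε) (hl : 0 < lam)
    (hf : Continuous f) {a b : unitInterval} (hab : a ≤ b) :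
    f '' Set.Icc a b = Set.univ ∨ ∃ c d : unitInterval, c ≤ d ∧
      lam / 2 * ((b : ℝ) - a) ≤ (d : ℝ) - c ∧ Set.Icc c d ⊆ f '' Set.Icc a b := by
  have hab' : (a : ℝ) ≤ b := hab
  have ha0 : 0 ≤ lam * a := mul_nonneg hl.le a.2.1
  have one_lap : ∀ (k : ℕ) (x y : unitInterval), k ≤ lam * x → lam * y ≤ k + 1 → x ≤ y →
      a ≤ x → y ≤ b → (b : ℝ) - a ≤ 2 * ((y : ℝ) - x) → ∃ c d : unitInterval, c ≤ d ∧
      lam / 2 * ((b : ℝ) - a) ≤ (d : ℝ) - c ∧ Set.Icc c d ⊆ f '' Set.Icc a b := by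
    intro k x y hx hy hxy hax hyb hlen
    have h1 := h.abs_apply_sub hl hx hy hxy
    have h2 := h.image_Icc hl hf hx hy hxy
    have h3 : f '' Set.Icc x y ⊆ f '' Set.Icc a b := Set.image_mono (Set.Icc_subset_Icc hax hyb)
    have h4 : lam / 2 * ((b : ℝ) - a) ≤ |(f y : ℝ) - f x| := by
      rw [h1]
      nlinarith
    rcases le_total (f x) (f y) with hc | hc
    · refine ⟨f x, f y, hc, ?_, ?_⟩
      · rwa [abs_of_nonneg (sub_nonneg.2 (show (f x : ℝ) ≤ f y from hc))] at h4
      · rwa [← Set.uIcc_of_le hc, ← h2]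
    · refine ⟨f y, f x, hc, ?_, ?_⟩
      · rwa [abs_sub_comm, abs_of_nonneg (sub_nonneg.2 (show (f y : ℝ) ≤ f x from hc))] at h4
      · rwa [← Set.uIcc_of_ge hc, ← h2]
  set k := ⌊lam * a⌋₊ with hk
  have hk1 : (k : ℝ) ≤ lam * a := Nat.floor_le ha0
  have hk2 : lam * a < k + 1 := Nat.lt_floor_add_one _
  by_cases hb1 : lam * b ≤ k + 1
  · exact Or.inr (one_lap k a b hk1 hb1 hab le_rfl le_rfl (by linarith))
  push Not at hb1
  have hm : (k + 1 : ℝ) / lam ≤ b := by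
    rw [div_le_iff₀ hl]
    linarith
  let m : unitInterval := ⟨(k + 1) / lam, by positivity, hm.trans b.2.2⟩
  have hlm : lam * (m : ℝ) = (k + 1 : ℕ) := by
    simp only [m]
    push_cast
    field_simp
  have ham : a ≤ m := show (a : ℝ) ≤ (k + 1) / lam by
    rw [le_div_iff₀ hl]
    linarith
  by_cases hb2 : lam * b ≤ (k + 1 : ℕ) + 1
  · right
    rcases le_total ((b : ℝ) - a) (2 * ((m : ℝ) - a)) with hh | hh
    · exact one_lap k a m hk1 (by rw [hlm]; push_cast; rfl) ham le_rfl hm hh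
    · exact one_lap (k + 1) m b hlm.ge hb2 hm ham le_rfl (by linarith)
  · left
    push Not at hb2
    have hm' : ((k + 1 : ℕ) + 1 : ℝ) / lam ≤ b := by
      rw [div_le_iff₀ hl]
      linarith
    let m' : unitInterval := ⟨((k + 1 : ℕ) + 1) / lam, by positivity, hm'.trans b.2.2⟩
    have hlm' : lam * (m' : ℝ) = (k + 1 : ℕ) + 1 := by
      simp only [m']
      field_simp
    exact Set.eq_univ_of_univ_subset ((h.image_full_lap hl hf hlm hlm').ge.trans
      (Set.image_mono (Set.Icc_subset_Icc ham hm')))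

/-- Every nondegenerate interval is eventually mapped onto `I`. -/
theorem exists_iterate_image_eq_univ (h : HasLapSigns lam f ε) (hl : 2 < lam)
    (hf : Continuous f) {a b : unitInterval} (hab : a < b) :
    ∃ n, f^[n] '' Set.Icc a b = Set.univ := by
  have hl0 : 0 < lam := by linarith
  have hab' : 0 < (b : ℝ) - a := sub_pos.2 hab
  by_contra! hne
  have key : ∀ n : ℕ, ∃ c d : unitInterval, c ≤ d ∧
      (lam / 2) ^ n * ((b : ℝ) - a) ≤ (d : ℝ) - c ∧ Set.Icc c d ⊆ f^[n] '' Set.Icc a b := by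
    intro n
    induction n with
    | zero => exact ⟨a, b, hab.le, by simp, by simp⟩
    | succ n ih =>
      obtain ⟨c, d, hcd, hlen, hsub⟩ := ih
      have hsub' : f '' Set.Icc c d ⊆ f^[n + 1] '' Set.Icc a b := by
        rw [Function.iterate_succ', Set.image_comp]
        exact Set.image_mono hsub
      rcases h.image_eq_univ_or_exists_Icc_subset hl0 hf hcd with hu | ⟨c', d', h1, h2, h3⟩
      · rw [hu] at hsub'
        exact absurd (Set.eq_univ_of_univ_subset hsub') (hne _)
      · refine ⟨c', d', h1, le_trans ?_ h2, h3.trans hsub'⟩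
        rw [pow_succ', mul_assoc]
        exact mul_le_mul_of_nonneg_left hlen (by positivity)
  obtain ⟨n, hn⟩ := pow_unbounded_of_one_lt (1 / ((b : ℝ) - a))
    (show 1 < lam / 2 by linarith)
  obtain ⟨c, d, -, hlen, -⟩ := key n
  rw [div_lt_iff₀ hab'] at hn
  linarith [c.2.1, d.2.2]

end HasLapSigns

/-! ### The postcritical set -/

theorem finite_range_iterate_of_mem_periodicPts {α : Type*} {g : α → α} {y : α}
    (hy : y ∈ Function.periodicPts g) : (Set.range fun n => g^[n] y).Finite := by
  refine ((Set.finite_Iio (Function.minimalPeriod g y)).image fun n => g^[n] y).subset ?_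
  rintro _ ⟨n, rfl⟩
  exact ⟨n % Function.minimalPeriod g y,
    Nat.mod_lt _ (Function.minimalPeriod_pos_of_mem_periodicPts hy),
    Function.iterate_mod_minimalPeriod_eq⟩

theorem IsZigZag.finite_weakPostcriticalSet (hf : IsZigZag lam f)
    (hp : IsPostcriticallyPeriodic f) : (weakPostcriticalSet f).Finite := by
  have hfin : (criticalSet f).Finite := by
    refine Set.Finite.of_finite_image (f := Subtype.val) ?_ Subtype.val_injective.injOn
    refine ((Set.finite_Iic ⌊lam⌋₊).image fun i : ℕ => (i : ℝ) * lam⁻¹).subset ?_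
    rintro _ ⟨c, hc, rfl⟩
    obtain ⟨i, -, hi, hci⟩ := (hf.critical_iff c hc.1 hc.2.1).1 hc
    exact ⟨i, hi, hci.symm⟩
  refine hfin.union ((hfin.biUnion fun c hc =>
    finite_range_iterate_of_mem_periodicPts (hp c hc)).subset ?_)
  rintro _ ⟨c, hc, n, hn, rfl⟩
  obtain ⟨m, rfl⟩ : ∃ m, n = m + 1 := ⟨n - 1, by omega⟩
  exact Set.mem_biUnion hc ⟨m, rfl⟩

theorem apply_mem_postcriticalSet_of_mem_criticalSet {c : unitInterval} (hc : c ∈ criticalSet f) :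
    f c ∈ postcriticalSet f :=
  ⟨c, hc, 1, le_rfl, rfl⟩

theorem apply_mem_postcriticalSet {y : unitInterval} (hy : y ∈ weakPostcriticalSet f) :
    f y ∈ postcriticalSet f := by
  rcases hy with hy | ⟨c, hc, n, hn, rfl⟩
  · exact apply_mem_postcriticalSet_of_mem_criticalSet hy
  · exact ⟨c, hc, n + 1, by omega, Function.iterate_succ_apply' f n c⟩

/-- The critical points `1 / lam` and `2 / lam` bound a full lap, so that both end points of `I` are
critical values. -/
theorem IsZigZag.endpoints_mem_postcriticalSet (hf : IsZigZag lam f) (hl : 2 < lam) :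
    0 ∈ postcriticalSet f ∧ 1 ∈ postcriticalSet f := by
  obtain ⟨ε, h⟩ := hf.exists_hasLapSigns
  have hl0 : 0 < lam := by linarith
  have h1 : 1 * lam⁻¹ < 1 := by rw [one_mul]; exact inv_lt_one_of_one_lt₀ (by linarith)
  have h2 : 2 * lam⁻¹ < 1 := by rw [← div_eq_mul_inv, div_lt_one hl0]; exact hl
  let x : unitInterval := ⟨1 * lam⁻¹, by positivity, h1.le⟩
  let y : unitInterval := ⟨2 * lam⁻¹, by positivity, h2.le⟩
  have hx0 : 0 < x := show (0 : ℝ) < 1 * lam⁻¹ by positivity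
  have hy0 : 0 < y := show (0 : ℝ) < 2 * lam⁻¹ by positivity
  have hxc : x ∈ criticalSet f := (hf.critical_iff x hx0 h1).2
    ⟨1, le_rfl, Nat.le_floor (by push_cast; linarith), by simp [x]⟩
  have hyc : y ∈ criticalSet f := (hf.critical_iff y hy0 h2).2
    ⟨2, by norm_num, Nat.le_floor (by push_cast; linarith), by simp [y]⟩
  have px := apply_mem_postcriticalSet_of_mem_criticalSet hxc
  have py := apply_mem_postcriticalSet_of_mem_criticalSet hyc
  have ex : lam * (x : ℝ) = (1 : ℕ) := by
    simp only [x]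
    field_simp
    simp
  have ey : lam * (y : ℝ) = (1 : ℕ) + 1 := by
    simp only [y]
    field_simp
    norm_num
  rcases h.full_lap ex ey with ⟨-, e1, e2⟩ | ⟨-, e1, e2⟩ <;> rw [e1] at px <;> rw [e2] at py
  · exact ⟨px, py⟩
  · exact ⟨py, px⟩

/-! ### Markov partitions and transition matrices -/

/-- A finite set of points of `I` that contains the end points can be listed in increasing order. -/
theorem exists_strictMono_range_eq {S : Set unitInterval} (hS : S.Finite) (h0 : 0 ∈ S)
    (h1 : 1 ∈ S) : ∃ (l : ℕ) (x : Fin (l + 1) → unitInterval), StrictMono x ∧ x 0 = 0 ∧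
      x (Fin.last l) = 1 ∧ Set.range x = S := by
  have hcard : hS.toFinset.card = hS.toFinset.card - 1 + 1 := by
    have : 0 < hS.toFinset.card := Finset.card_pos.2 ⟨0, hS.mem_toFinset.2 h0⟩
    omega
  let x := hS.toFinset.orderEmbOfFin hcard
  have hr : Set.range x = S := by
    rw [Finset.range_orderEmbOfFin, hS.coe_toFinset]
  refine ⟨_, x, x.strictMono, ?_, ?_, hr⟩
  · obtain ⟨i, hi⟩ := hr.ge h0
    exact le_antisymm ((x.monotone (Fin.zero_le i)).trans hi.le) unitInterval.nonneg'
  · obtain ⟨i, hi⟩ := hr.ge h1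
    exact le_antisymm unitInterval.le_one' (hi.ge.trans (x.monotone (Fin.le_last i)))

section Pieces

variable {l : ℕ} {x : Fin (l + 1) → unitInterval}

theorem exists_mem_piece (hx : Monotone x) {p q : Fin (l + 1)} (hpq : x p < x q)
    {z : unitInterval} (hz : z ∈ Set.Icc (x p) (x q)) :
    ∃ i : Fin l, p ≤ i.castSucc ∧ i.succ ≤ q ∧ z ∈ piece x i := by
  by_contra! hne
  have key : ∀ j : Fin (l + 1), p ≤ j → j ≤ q → j = p ∨ x j < z := by
    refine Fin.induction (fun h _ => Or.inl (le_antisymm (Fin.zero_le _) h)) fun i ih hp hq => ?_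
    rcases hp.eq_or_lt with he | hlt
    · exact Or.inl he.symm
    · have hpi : p ≤ i.castSucc := Fin.le_castSucc_iff.2 hlt
      have hxi : x i.castSucc ≤ z := by
        rcases ih hpi ((Fin.castSucc_le_succ i).trans hq) with h | h
        · rw [h]; exact hz.1
        · exact h.le
      exact Or.inr (lt_of_not_ge fun h => hne i hpi hq ⟨hxi, h⟩)
  rcases key q (hx.reflect_lt hpq).le le_rfl with h | h
  · exact hpq.ne' (by rw [h])
  · exact absurd hz.2 (not_le.2 h)

theorem Icc_eq_iUnion_piece (hx : Monotone x) {p q : Fin (l + 1)} (hpq : x p < x q) :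
    Set.Icc (x p) (x q) = ⋃ j ∈ {j : Fin l | p ≤ j.castSucc ∧ j.succ ≤ q}, piece x j := by
  ext z
  simp only [Set.mem_iUnion, Set.mem_ofPred_eq, exists_prop]
  refine ⟨fun hz => ?_, ?_⟩
  · obtain ⟨i, h1, h2, h3⟩ := exists_mem_piece hx hpq hz
    exact ⟨i, ⟨h1, h2⟩, h3⟩
  · rintro ⟨i, ⟨h1, h2⟩, h3⟩
    exact ⟨(hx h1).trans h3.1, h3.2.trans (hx h2)⟩

/-- Each piece has a point that lies in no other piece. -/
theorem exists_mem_piece_unique (hx : StrictMono x) (i : Fin l) :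
    ∃ z ∈ piece x i, ∀ j, z ∈ piece x j → j = i := by
  obtain ⟨z, h1, h2⟩ := exists_between (hx (Fin.castSucc_lt_succ (i := i)))
  refine ⟨z, ⟨h1.le, h2.le⟩, fun j hj => ?_⟩
  have h3 : i.castSucc < j.succ := hx.lt_iff_lt.1 (h1.trans_le hj.2)
  have h4 : j.castSucc < i.succ := hx.lt_iff_lt.1 (hj.1.trans_lt h2)
  rw [Fin.lt_def] at h3 h4
  simp only [Fin.val_castSucc, Fin.val_succ] at h3 h4
  exact Fin.ext (by omega)

theorem transitionMatrix_nonneg (i j : Fin l) : 0 ≤ transitionMatrix f x i j := by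
  simp only [transitionMatrix, Matrix.of_apply]
  split_ifs <;> norm_num

/-- The pieces that the `n`-th power of the transition matrix allows cover `f^n` of a piece. -/
theorem IsMarkovPartition.iterate_image_piece_subset (hx : IsMarkovPartition f x) (j : Fin l)
    (n : ℕ) : (∀ i, 0 ≤ (transitionMatrix f x ^ n) i j) ∧
      f^[n] '' piece x j ⊆ ⋃ i ∈ {i | 0 < (transitionMatrix f x ^ n) i j}, piece x i := by
  induction n with
  | zero =>
    refine ⟨fun i => ?_, ?_⟩
    · rw [pow_zero, Matrix.one_apply]
      split_ifs <;> norm_num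
    · simp only [Function.iterate_zero, Set.image_id]
      exact Set.subset_biUnion_of_mem (u := fun i => piece x i) (by simp)
  | succ n ih =>
    obtain ⟨ih0, ih⟩ := ih
    have hmul : ∀ i, (transitionMatrix f x ^ (n + 1)) i j =
        ∑ k, transitionMatrix f x i k * (transitionMatrix f x ^ n) k j := fun i => by
      rw [pow_succ', Matrix.mul_apply]
    refine ⟨fun i => ?_, ?_⟩
    · rw [hmul]
      exact Finset.sum_nonneg fun k _ => mul_nonneg (transitionMatrix_nonneg i k) (ih0 k)
    · rw [Function.iterate_succ', Set.image_comp]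
      rintro _ ⟨y, hy, rfl⟩
      obtain ⟨k, hk, hyk⟩ := Set.mem_iUnion₂.1 (ih hy)
      obtain ⟨S, hS⟩ := hx.image k
      obtain ⟨i, hi, hyi⟩ := Set.mem_iUnion₂.1 (hS.le ⟨y, hyk, rfl⟩)
      refine Set.mem_iUnion₂.2 ⟨i, ?_, hyi⟩
      have hik : transitionMatrix f x i k = 1 := by
        simp only [transitionMatrix, Matrix.of_apply]
        rw [if_pos]
        rw [hS]
        exact Set.subset_biUnion_of_mem (u := fun i => piece x i) hi
      rw [Set.mem_ofPred_eq, hmul]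
      refine Finset.sum_pos' (fun k _ => mul_nonneg (transitionMatrix_nonneg i k) (ih0 k))
        ⟨k, Finset.mem_univ k, ?_⟩
      rw [hik, one_mul]
      exact hk

/-- If every piece is eventually mapped onto `I`, then the transition matrix is primitive. -/
theorem IsMarkovPartition.isPrimitive (hx : IsMarkovPartition f x) (hf : Function.Surjective f)
    (h : ∀ j, ∃ n, f^[n] '' piece x j = Set.univ) : (transitionMatrix f x).IsPrimitive := by
  choose N hN using h
  refine ⟨transitionMatrix_nonneg, (∑ j, N j) + 1, Nat.succ_pos _, fun i j => ?_⟩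
  obtain ⟨m, hm⟩ : ∃ m, (∑ j, N j) + 1 = m + N j :=
    Nat.exists_eq_add_of_le' ((Finset.single_le_sum (fun _ _ => Nat.zero_le _)
      (Finset.mem_univ j)).trans (Nat.le_succ _))
  have hu : f^[m + N j] '' piece x j = Set.univ := by
    rw [Function.iterate_add, Set.image_comp, hN, Set.image_univ,
      (hf.iterate m).range_eq]
  rw [hm]
  obtain ⟨z, -, hz⟩ := exists_mem_piece_unique hx.strictMono i
  have hz' := (hx.iterate_image_piece_subset j (m + N j)).2 (hu.ge (Set.mem_univ z))
  obtain ⟨k, hk, hzk⟩ := Set.mem_iUnion₂.1 hz'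
  rwa [hz k hzk] at hk

/-- A piece of a partition that cuts at all critical points lies in a single lap. -/
theorem IsZigZag.exists_lap_of_piece (hf : IsZigZag lam f) (hx : StrictMono x)
    (hr : criticalSet f ⊆ Set.range x) (i : Fin l) :
    ∃ k : ℕ, k ≤ lam * x i.castSucc ∧ lam * x i.succ ≤ k + 1 := by
  have hl0 : 0 < lam := by linarith [hf.expander.one_lt]
  have h0 : 0 ≤ lam * x i.castSucc := mul_nonneg hl0.le (x i.castSucc).2.1
  refine ⟨⌊lam * x i.castSucc⌋₊, Nat.floor_le h0, ?_⟩
  set k := ⌊lam * x i.castSucc⌋₊ with hk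
  have hk2 : lam * x i.castSucc < k + 1 := Nat.lt_floor_add_one _
  by_contra! hlt
  have hc2 : (k + 1 : ℝ) * lam⁻¹ < x i.succ := by
    rw [← div_eq_mul_inv, div_lt_iff₀ hl0]
    linarith
  have hc1 : x i.castSucc < (k + 1 : ℝ) * lam⁻¹ := by
    rw [← div_eq_mul_inv, lt_div_iff₀ hl0]
    linarith
  let c : unitInterval := ⟨(k + 1) * lam⁻¹, by positivity, hc2.le.trans (x i.succ).2.2⟩
  have hc0 : 0 < c := show (0 : ℝ) < (k + 1) * lam⁻¹ by positivity
  have hcl : c < 1 := hc2.trans_le (x i.succ).2.2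
  have hc : c ∈ criticalSet f := by
    refine (hf.critical_iff c hc0 hcl).2 ⟨k + 1, by omega, Nat.le_floor ?_, by simp [c]⟩
    have : (k + 1 : ℝ) * lam⁻¹ < 1 := hcl
    rw [← div_eq_mul_inv, div_lt_one hl0] at this
    push_cast
    exact this.le
  obtain ⟨j, hj⟩ := hr hc
  have h3 : i.castSucc < j := hx.lt_iff_lt.1 (by rw [hj]; exact hc1)
  have h4 : j < i.succ := hx.lt_iff_lt.1 (by rw [hj]; exact hc2)
  rw [Fin.lt_def] at h3 h4
  simp only [Fin.val_castSucc, Fin.val_succ] at h3 h4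
  omega

theorem IsZigZag.isMarkovPartition (hf : IsZigZag lam f) (hx : StrictMono x) (h0 : x 0 = 0)
    (h1 : x (Fin.last l) = 1) (hr : criticalSet f ⊆ Set.range x)
    (hmaps : Set.MapsTo f (Set.range x) (Set.range x)) : IsMarkovPartition f x := by
  obtain ⟨ε, h⟩ := hf.exists_hasLapSigns
  have hl0 : 0 < lam := by linarith [hf.expander.one_lt]
  refine ⟨hx, h0, h1, fun i => ?_, fun i => ?_⟩
  · obtain ⟨k, hk1, hk2⟩ := hf.exists_lap_of_piece hx hr i
    have hlt : x i.castSucc < x i.succ := hx (Fin.castSucc_lt_succ (i := i))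
    have himg := h.image_Icc hl0 hf.expander.continuous hk1 hk2 hlt.le
    have hne : f (x i.castSucc) ≠ f (x i.succ) := fun he =>
      hlt.ne (h.injOn_Icc hl0 hk1 hk2 ⟨le_rfl, hlt.le⟩ ⟨hlt.le, le_rfl⟩ he)
    obtain ⟨p, hp⟩ := hmaps (Set.mem_range_self i.castSucc)
    obtain ⟨q, hq⟩ := hmaps (Set.mem_range_self i.succ)
    rw [piece, himg]
    rw [← hp, ← hq] at hne ⊢
    rcases lt_or_gt_of_ne hne with hc | hc
    · rw [Set.uIcc_of_lt hc]
      exact ⟨_, Icc_eq_iUnion_piece hx.monotone hc⟩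
    · rw [Set.uIcc_of_gt hc]
      exact ⟨_, Icc_eq_iUnion_piece hx.monotone hc⟩
  · obtain ⟨k, hk1, hk2⟩ := hf.exists_lap_of_piece hx hr i
    exact (h.injOn_Icc hl0 hk1 hk2).mono Set.Ioo_subset_Icc_self

end Pieces

theorem IsZigZag.exists_isMarkovPartition_isPrimitive (hf : IsZigZag lam f) (hl : 2 < lam)
    (hp : IsPostcriticallyPeriodic f) :
    ∃ (l : ℕ) (x : Fin (l + 1) → unitInterval), IsMarkovPartition f x ∧
      Set.range x = {0, 1} ∪ weakPostcriticalSet f ∧ (transitionMatrix f x).IsPrimitive := by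
  obtain ⟨ε, h⟩ := hf.exists_hasLapSigns
  have hc := hf.expander.continuous
  obtain ⟨p0, p1⟩ := hf.endpoints_mem_postcriticalSet hl
  have hS : {0, 1} ∪ weakPostcriticalSet f = weakPostcriticalSet f :=
    Set.union_eq_self_of_subset_left (Set.pair_subset (Or.inr p0) (Or.inr p1))
  obtain ⟨l, x, hx, h0, h1, hr⟩ := exists_strictMono_range_eq
    (hf.finite_weakPostcriticalSet hp) (Or.inr p0) (Or.inr p1)
  have hM : IsMarkovPartition f x := by
    refine hf.isMarkovPartition hx h0 h1 ?_ ?_ <;> rw [hr]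
    · exact Set.subset_union_left
    · exact fun y hy => Or.inr (apply_mem_postcriticalSet hy)
  exact ⟨l, x, hM, hr.trans hS.symm, hM.isPrimitive (h.surjective (by linarith) hc)
    fun j => h.exists_iterate_image_eq_univ hl hc (hx Fin.castSucc_lt_succ)⟩

end IntervalMap

theorem mainTheorem7 (lam : ℝ) (hlam : 2 < lam) (f : unitInterval → unitInterval)
    (hf : IntervalMap.IsZigZag lam f) :
    (∃ ν : MeasureTheory.Measure unitInterval,
      ν.AbsolutelyContinuous MeasureTheory.volume ∧
      (MeasureTheory.volume : MeasureTheory.Measure unitInterval).AbsolutelyContinuous ν ∧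
      IntervalMap.IsWeakMixing f ν ∧
      ∀ ν' : MeasureTheory.Measure unitInterval, MeasureTheory.IsProbabilityMeasure ν' →
        ν'.AbsolutelyContinuous MeasureTheory.volume →
        MeasureTheory.MeasurePreserving f ν' ν' → ν' = ν) ∧
    (IntervalMap.IsPostcriticallyPeriodic f →
      ∃ (l : ℕ) (x : Fin (l + 1) → unitInterval),
        IntervalMap.IsMarkovPartition f x ∧
        Set.range x = {0, 1} ∪ IntervalMap.weakPostcriticalSet f ∧
        (IntervalMap.transitionMatrix f x).IsPrimitive) := by
  exact ⟨hf.exists_isWeakMixing hlam, hf.exists_isMarkovPartition_isPrimitive hlam⟩
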